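/- Let $\beta\omega$ be the Čech–Stone compactification of the discrete space $\omega$ of natural numbers, whose points are the ultrafilters on $\omega$, and let $\omega^*=\beta\omega\setminus\omega$ be the set of nonprincipal ultrafilters. Let $C(\beta\omega)$ be the Banach space of continuous real-valued functions on $\beta\omega$ with the supremum norm, and let $\tau_p$, $weak$ and $norm$ denote its pointwise, weak and norm topologies. For a topology $\tau$ on a set $X$, let $Bor(X,\tau)$ be the $\sigma$-algebra generated by the $\tau$-open sets, and let $Ba(X,\tau)$ be the smallest $\sigma$-algebra on $X$ making all $\tau$-continuous functions $X\to\mathbb R$ measurable. (1) Let $(A_\alpha)_{\alpha\in I}$ be an almost disjoint family of infinite subsets of $\omega$ (that is, $A_\alpha\cap A_{\alpha'}$ is finite whenever $\alpha\neq\alpha'$) indexed by an uncountable set $I$ (for example $I=\omega_1$), and for every $\alpha\in I$ let $\mathcal F_\alpha\in\omega^*$ be such that $A_\alpha\in\mathcal F_\alpha$. Then the set $$V=\{f\in C(\beta\omega): f(\mathcal F_\alpha)>0\text{ for some }\alpha\in I\}$$ is $\tau_p$-open, and $V\notin Ba(C(\beta\omega),weak)$. (2) $Bor(C(\beta\omega),\tau_p)\not\subseteq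 Ba(C(\beta\omega),weak)$. (3) All the following inclusions hold and are strict: $$Ba(C(\beta\omega),\tau_p)\subsetneq Bor(C(\beta\omega),\tau_p)\subsetneq Bor(C(\beta\omega),weak)\subsetneq Bor(C(\beta\omega),norm),$$ $$Ba(C(\beta\omega),\tau_p)\subsetneq Ba(C(\beta\omega),weak)\subsetneq Bor(C(\beta\omega),weak).$$ -/

import Mathlib

open scoped Topology MeasureTheory

/-- The Čech-Stone compactification `βω` of the discrete space `ω` of natural numbers, realized as
the space of all ultrafilters on `ω` with Mathlib's (Stone) topology. -/
abbrev BetaOmega : Type := Ultrafilter ℕ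

/-- The remainder `ω* = βω ∖ ω`: the nonprincipal ultrafilters. -/
def omegaStar : Set BetaOmega := (Set.range (pure : ℕ → Ultrafilter ℕ))ᶜ

/-- An (indexed) almost disjoint family of infinite subsets of `ω`. -/
def IsAlmostDisjointFamily {ι : Type*} (A : ι → Set ℕ) : Prop :=
  (∀ i, (A i).Infinite) ∧ ∀ i j, i ≠ j → (A i ∩ A j).Finite

/-- The supremum norm topology on `C(K)`. -/
@[reducible] noncomputable def normTopology (K : Type*) [TopologicalSpace K] [CompactSpace K] :
    TopologicalSpace C(K, ℝ) :=
  (PseudoMetricSpace.toUniformSpace : UniformSpace C(K, ℝ)).toTopologicalSpace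

/-- The weak topology on the Banach space `C(K)`. -/
@[reducible] noncomputable def weakTopology (K : Type*) [TopologicalSpace K] [CompactSpace K] :
    TopologicalSpace C(K, ℝ) :=
  TopologicalSpace.induced (toWeakSpace ℝ C(K, ℝ)) inferInstance

/-- The topology of pointwise convergence on `C(K)`. -/
@[reducible] noncomputable def pointwiseTopology (K : Type*) [TopologicalSpace K] :
    TopologicalSpace C(K, ℝ) :=
  TopologicalSpace.induced (fun (f : C(K, ℝ)) (x : K) => f x) Pi.topologicalSpace

/-- The Baire σ-algebra of a topological space `(X, t)`: the smallest σ-algebra on `X` making all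
`t`-continuous real-valued functions measurable. -/
@[reducible] noncomputable def baireSigmaAlgebra {X : Type*} (t : TopologicalSpace X) :
    MeasurableSpace X :=
  ⨆ f : {f : X → ℝ // @Continuous X ℝ t inferInstance f}, MeasurableSpace.comap f.1 (borel ℝ)

/-- The Borel σ-algebra of a topological space `(X, t)`. -/
@[reducible] noncomputable def borelSigmaAlgebra {X : Type*} (t : TopologicalSpace X) :
    MeasurableSpace X :=
  @borel X t

/-- The set of `f ∈ C(βω)` that are positive at some point of the family `(F i)`. -/
def positiveSomewhere {ι : Type*} (F : ι → BetaOmega) : Set C(BetaOmega, ℝ) :=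
  {f | ∃ i, 0 < f (F i)}

/-!
Weakly Baire sets: the values at a Hamel basis of the dual embed `C(βω)` densely into a product of
lines, where closures of open sets depend on countably many coordinates. Hence `Ba(weak)` is
generated by the functionals (Edgar). Given a functional `φ` and an almost disjoint family `A`, for
all but countably many `i` the value `φ(1_B)`, `B ⊆ A i`, is the limit of `φ(1_{B ∩ T})` over
finite `T`. So a weakly Baire set traces a Borel set on `2^{A i}` for all but countably many `i`,
while `V` traces the nonprincipal ultrafilter `F i`, which lacks the Baire property there: a
measurable finitely additive function that vanishes on finite sets is zero.

Borel sets: a Borel set is generated by countably many open sets, and fusion finds a set `A` and a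
large set `N` such that all of these trace open sets on the family of sets that agree with `A`
outside `N`.
* For the pointwise topology `Nᶜ` can be made small in the sense of density. So if a functional
  bounded by density and vanishing on finite sets were pointwise Borel, it would vanish on `1_N`,
  although it is at most `1/2` on `1_{Nᶜ}` and equal to `1` on the constant function `1`.
* For the weak topology `N` can be made infinite, because on an infinite set `N` a functional is
  small on all subsets of some infinite `C ⊆ N`. Distinct indicators have distance one, so every
  set of them is norm closed, in particular the set of all `1_A` with `p A`, where `p` is a
  property that any one-point change of `A` reverses. Its trace fails the Baire property.
-/

/-! ### Baire category in `ι → Bool` -/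

section BaireCategory

variable {ι : Type*}

theorem tendsto_residual_piMap {X Y : ι → Type*} [∀ i, TopologicalSpace (X i)]
    [∀ i, DiscreteTopology (X i)] [∀ i, TopologicalSpace (Y i)] [∀ i, DiscreteTopology (Y i)]
    {f : ∀ i, X i → Y i} (hf : ∀ i, Function.Surjective (f i)) :
    Filter.Tendsto (Pi.map f) (residual (∀ i, X i)) (residual (∀ i, Y i)) :=
  tendsto_residual_of_isOpenMap (.piMap fun _ => continuous_of_discreteTopology)
    (.piMap (fun _ _ _ => isOpen_discrete _) (.of_forall hf))

open Classical in
/-- The point of `ι → Bool` obtained from `x` by switching the coordinates in `t`. -/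
noncomputable def flipOn (t : Set ι) (x : ι → Bool) : ι → Bool :=
  Pi.map (fun i b => if i ∈ t then !b else b) x

theorem flipOn_apply_of_mem {t : Set ι} {i : ι} (hi : i ∈ t) (x : ι → Bool) :
    flipOn t x i = !x i :=
  if_pos hi

theorem flipOn_apply_of_notMem {t : Set ι} {i : ι} (hi : i ∉ t) (x : ι → Bool) :
    flipOn t x i = x i :=
  if_neg hi

theorem eventually_residual_flipOn (t : Set ι) {p : (ι → Bool) → Prop}
    (hp : ∀ᶠ x in residual (ι → Bool), p x) : ∀ᶠ x in residual (ι → Bool), p (flipOn t x) := by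
  classical
  refine (tendsto_residual_piMap fun i => ?_).eventually hp
  by_cases hi : i ∈ t
  · simpa only [hi, if_true] using Bool.not_surjective
  · simp only [hi, if_false]
    exact Function.surjective_id

theorem frequently_residual_cylinder (I : Finset ι) (x₀ : ι → Bool) :
    ∃ᶠ x in residual (ι → Bool), ∀ i ∈ I, x i = x₀ i := by
  intro h
  have hopen : IsOpen ((I : Set ι).pi fun i => {x₀ i}) :=
    isOpen_set_pi I.finite_toSet fun _ _ => isOpen_discrete _
  obtain ⟨x, hx, hxS⟩ := (dense_of_mem_residual h).inter_open_nonempty _ hopen ⟨x₀, by simp⟩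
  exact hxS fun i hi => hx i hi

theorem eventually_notMem_or_exists_cylinder {S : Set (ι → Bool)} (hS : BaireMeasurableSet S) :
    (∀ᶠ x in residual (ι → Bool), x ∉ S) ∨ ∃ (I : Finset ι) (x₀ : ι → Bool),
      ∀ᶠ x in residual (ι → Bool), (∀ i ∈ I, x i = x₀ i) → x ∈ S := by
  obtain ⟨U, hU, hSU⟩ := hS.residualEq_isOpen
  rcases U.eq_empty_or_nonempty with rfl | ⟨x₀, hx₀⟩
  · exact .inl (hSU.mem_iff.mono fun x hx => hx.not.2 (Set.notMem_empty x))
  · obtain ⟨I, u, hu, huU⟩ := isOpen_pi_iff.1 hU x₀ hx₀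
    refine .inr ⟨I, x₀, hSU.mem_iff.mono fun x hx hxI => hx.2 (huU fun i hi => ?_)⟩
    rw [hxI i hi]
    exact (hu i hi).2

theorem eventually_mem_or_eventually_notMem_of_tail {S : Set (ι → Bool)}
    (hS : BaireMeasurableSet S) (htail : ∀ t : Set ι, t.Finite → ∀ x, flipOn t x ∈ S → x ∈ S) :
    (∀ᶠ x in residual (ι → Bool), x ∈ S) ∨ (∀ᶠ x in residual (ι → Bool), x ∉ S) := by
  classical
  refine (eventually_notMem_or_exists_cylinder hS).symm.imp_left fun ⟨I, x₀, hI⟩ => ?_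
  have hflip : ∀ᶠ x in residual (ι → Bool), ∀ t ∈ I.powerset,
      (∀ i ∈ I, flipOn t x i = x₀ i) → flipOn t x ∈ S :=
    I.powerset.eventually_all.2 fun t _ => eventually_residual_flipOn _ hI
  filter_upwards [hflip] with x hx
  set t : Finset ι := I.filter fun i => x i ≠ x₀ i with ht
  refine htail t t.finite_toSet x (hx t (by simp [ht]) fun i hi => ?_)
  by_cases hit : x i = x₀ i
  · rw [flipOn_apply_of_notMem (by simp [ht, hit]), hit]
  · rw [flipOn_apply_of_mem (by simp [ht, hi, hit]), Bool.not_eq.2 hit]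

theorem not_baireMeasurableSet_of_parity [Infinite ι] {Z : Set (ι → Bool)}
    (hZ : ∀ (x : ι → Bool) (i : ι), flipOn {i} x ∈ Z ↔ x ∉ Z) : ¬ BaireMeasurableSet Z := by
  intro h
  rcases eventually_notMem_or_exists_cylinder h with hnot | ⟨I, x₀, hI⟩
  · obtain ⟨i⟩ : Nonempty ι := inferInstance
    obtain ⟨x, hx, hx'⟩ :=
      (dense_of_mem_residual (hnot.and (eventually_residual_flipOn {i} hnot))).nonempty
    exact hx' ((hZ x i).2 hx)
  · obtain ⟨i, hi⟩ := Infinite.exists_notMem_finset I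
    obtain ⟨x, hxI, hx, hx'⟩ := ((frequently_residual_cylinder I x₀).and_eventually
      (hI.and (eventually_residual_flipOn {i} hI))).exists
    refine (hZ x i).1 (hx' fun j hj => ?_) (hx hxI)
    exact (flipOn_apply_of_notMem (t := {i}) (ne_of_mem_of_not_mem hj hi) x).trans
      (hxI j hj)

end BaireCategory

/-! ### Finitely additive functions vanishing on finite sets -/

section Additive

variable {α : Type*} {N : Set α}

/-- The subset of `N` with characteristic function `x`, as a set in the ambient type. -/
def codedSet (x : N → Bool) : Set α :=
  Subtype.val '' {n | x n = true}

theorem mem_codedSet_iff {x : N → Bool} {a : α} (ha : a ∈ N) :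
    a ∈ codedSet x ↔ x ⟨a, ha⟩ = true := by
  simp [codedSet, ha]

theorem codedSet_subset (x : N → Bool) : codedSet x ⊆ N :=
  Subtype.coe_image_subset N _

variable {ν : Set α → ℝ}

theorem eq_of_finite_sdiff (hadd : ∀ B C, Disjoint B C → ν (B ∪ C) = ν B + ν C)
    (hfin : ∀ B : Set α, B.Finite → ν B = 0) {B C : Set α} (hBC : (B \ C).Finite)
    (hCB : (C \ B).Finite) : ν B = ν C := by
  have hinter (B C : Set α) (h : (B \ C).Finite) : ν B = ν (B ∩ C) := by
    rw [← Set.inter_union_sdiff B C, hadd _ _ Set.disjoint_sdiff_inter.symm, hfin _ h, add_zero,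
      Set.inter_union_sdiff]
  rw [hinter B C hBC, hinter C B hCB, Set.inter_comm]

theorem exists_residual_eq_const (hadd : ∀ B C, Disjoint B C → ν (B ∪ C) = ν B + ν C)
    (hfin : ∀ B : Set α, B.Finite → ν B = 0)
    (hmeas : Measurable fun x : N → Bool => ν (codedSet x)) :
    ∃ c, ∀ᶠ x in residual (N → Bool), ν (codedSet x) = c := by
  have htail (t : Set N) (ht : t.Finite) (x : N → Bool) :
      ν (codedSet (flipOn t x)) = ν (codedSet x) := by
    have hsub (y z : N → Bool) (hyz : ∀ n, n ∉ t → y n = z n) :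
        (codedSet y \ codedSet z).Finite := by
      refine (ht.image Subtype.val).subset ?_
      rintro _ ⟨⟨n, hn, rfl⟩, hnz⟩
      refine ⟨n, of_not_not fun hnt => hnz ⟨n, ?_, rfl⟩, rfl⟩
      exact (hyz n hnt).symm.trans hn
    exact eq_of_finite_sdiff hadd hfin
      (hsub _ _ fun n hn => flipOn_apply_of_notMem hn x)
      (hsub _ _ fun n hn => (flipOn_apply_of_notMem hn x).symm)
  refine Filter.exists_eventuallyEq_const_of_forall_separating MeasurableSet fun s hs => ?_
  borelize (N → Bool)
  refine eventually_mem_or_eventually_notMem_of_tail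
    (S := (fun x : N → Bool => ν (codedSet x)) ⁻¹' s)
    (pi_le_borel_pi _ (hmeas hs)).baireMeasurableSet fun t ht x hx => ?_
  rwa [Set.mem_preimage, htail t ht] at hx

/-- For a generic `p : N → Fin 3`, the function `ν` takes the same value on the sets `{p = 0}`,
`{p = 1}`, `{p = 2}` and on the union of the first two, so this value is zero. -/
theorem eq_zero_of_additive_of_measurable (hadd : ∀ B C, Disjoint B C → ν (B ∪ C) = ν B + ν C)
    (hfin : ∀ B : Set α, B.Finite → ν B = 0)
    (hmeas : Measurable fun x : N → Bool => ν (codedSet x)) : ν N = 0 := by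
  obtain ⟨c, hc⟩ := exists_residual_eq_const hadd hfin hmeas
  have hgeneric (q : Fin 3 → Bool) (hq : Function.Surjective q) :
      ∀ᶠ p in residual (N → Fin 3), ν (codedSet fun n => q (p n)) = c :=
    (tendsto_residual_piMap fun _ => hq).eventually hc
  obtain ⟨p, h0, h1, h2, h01⟩ := (dense_of_mem_residual <|
    (hgeneric (· = 0) (by decide)).and <| (hgeneric (· = 1) (by decide)).and <|
      (hgeneric (· = 2) (by decide)).and (hgeneric (· ≠ 2) (by decide))).nonempty
  have hunion (q r s : Fin 3 → Bool) (hqr : ∀ i, (q i && r i) = false)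
      (hs : ∀ i, (q i || r i) = s i) :
      ν (codedSet fun n => s (p n)) = ν (codedSet fun n => q (p n)) +
        ν (codedSet fun n => r (p n)) := by
    rw [← hadd]
    · simp only [codedSet, ← Set.image_union, ← hs, Bool.or_eq_true, Set.ofPred_or]
    · refine Set.disjoint_image_of_injective Subtype.val_injective
        (Set.disjoint_left.2 fun n hn hn' => ?_)
      simpa [hn.out, hn'.out] using hqr (p n)
  have hc0 := hunion (· = 0) (· = 1) (· ≠ 2) (by decide) (by decide)
  have hN := hunion (· ≠ 2) (· = 2) (fun _ => true) (by decide) (by decide)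
  rw [show codedSet (fun _ : N => true) = N by simp [codedSet]] at hN
  linarith

end Additive

/-! ### Edgar's theorem on the Baire σ-algebra of a weak topology -/

section WeaklyLindelof

open MeasureTheory TopologicalSpace

theorem isOpenPosMeasure_infinitePi {B : Type*} {X : B → Type*} [∀ b, TopologicalSpace (X b)]
    [∀ b, MeasurableSpace (X b)] [∀ b, OpensMeasurableSpace (X b)] (μ : ∀ b, Measure (X b))
    [∀ b, IsProbabilityMeasure (μ b)] [∀ b, (μ b).IsOpenPosMeasure] :
    (Measure.infinitePi μ).IsOpenPosMeasure where
  open_pos U hU := by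
    rintro ⟨x, hx⟩
    obtain ⟨t, u, hu, huU⟩ := isOpen_pi_iff.1 hU x hx
    refine ne_bot_of_le_ne_bot ?_ (measure_mono huU)
    rw [bot_eq_zero, Measure.infinitePi_pi μ fun b hb => (hu b hb).1.measurableSet]
    exact Finset.prod_ne_zero_iff.2 fun b hb => (hu b hb).1.measure_ne_zero _ ⟨x b, (hu b hb).2⟩

theorem countable_of_pairwiseDisjoint_isOpen {Y : Type*} [TopologicalSpace Y] [MeasurableSpace Y]
    (μ : Measure Y) [SFinite μ] [μ.IsOpenPosMeasure] {𝒞 : Set (Set Y)}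
    (hopen : ∀ C ∈ 𝒞, IsOpen C) (hne : ∀ C ∈ 𝒞, C.Nonempty)
    (hmeas : ∀ C ∈ 𝒞, MeasurableSet C) (hdisj : 𝒞.PairwiseDisjoint id) : 𝒞.Countable := by
  have hpos := Measure.countable_meas_pos_of_disjoint_iUnion (μ := μ)
    (As := fun C : 𝒞 => (C : Set Y)) (fun C => hmeas C C.2) fun C D hCD =>
      hdisj C.2 D.2 (Subtype.coe_injective.ne hCD)
  have huniv : {C : 𝒞 | 0 < μ C} = Set.univ :=
    Set.eq_univ_of_forall fun C => (hopen C C.2).measure_pos μ (hne C C.2)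
  rw [huniv, Set.countable_univ_iff] at hpos
  exact Set.countable_coe_iff.1 hpos

theorem exists_countable_subset_closure_sUnion {Y : Type*} [TopologicalSpace Y]
    [MeasurableSpace Y] (μ : Measure Y) [SFinite μ] [μ.IsOpenPosMeasure] {𝓑 : Set (Set Y)}
    (h𝓑 : IsTopologicalBasis 𝓑) (hmeas : ∀ C ∈ 𝓑, MeasurableSet C) {W : Set Y} (hW : IsOpen W) :
    ∃ 𝒞 ⊆ 𝓑, 𝒞.Countable ∧ ⋃₀ 𝒞 ⊆ W ∧ W ⊆ closure (⋃₀ 𝒞) := by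
  obtain ⟨𝒞, h𝒞⟩ := zorn_subset
    {𝒞 | (∀ C ∈ 𝒞, C ∈ 𝓑 ∧ C.Nonempty ∧ C ⊆ W) ∧ 𝒞.PairwiseDisjoint id} fun 𝒦 h𝒦 hchain => by
      refine ⟨⋃₀ 𝒦, ⟨?_, ?_⟩, fun _ => Set.subset_sUnion_of_mem⟩
      · rintro C ⟨𝒞, h𝒞, hC⟩
        exact (h𝒦 h𝒞).1 C hC
      · exact (Set.pairwiseDisjoint_sUnion hchain.directedOn).2 fun 𝒞 h𝒞 => (h𝒦 h𝒞).2
  refine ⟨𝒞, fun C hC => (h𝒞.1.1 C hC).1, ?_, Set.sUnion_subset fun C hC => (h𝒞.1.1 C hC).2.2, ?_⟩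
  · exact countable_of_pairwiseDisjoint_isOpen μ (fun C hC => h𝓑.isOpen (h𝒞.1.1 C hC).1)
      (fun C hC => (h𝒞.1.1 C hC).2.1) (fun C hC => hmeas C (h𝒞.1.1 C hC).1) h𝒞.1.2
  · intro y hyW
    refine h𝓑.mem_closure_iff.2 fun O hO hyO => ?_
    obtain ⟨C, hC, hyC, hCOW⟩ := h𝓑.exists_subset_of_mem_open (Set.mem_inter hyO hyW)
      ((h𝓑.isOpen hO).inter hW)
    by_contra hdisj
    have hCdisj : Disjoint C (⋃₀ 𝒞) := (Set.disjoint_iff_inter_eq_empty.2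
      (Set.not_nonempty_iff_eq_empty.1 hdisj)).mono_left (hCOW.trans Set.inter_subset_left)
    have hC𝒞 : C ∈ 𝒞 := h𝒞.le_of_ge (y := insert C 𝒞)
      ⟨Set.forall_mem_insert.2 ⟨⟨hC, ⟨y, hyC⟩, hCOW.trans Set.inter_subset_right⟩, h𝒞.1.1⟩,
        h𝒞.1.2.insert fun D hD _ => hCdisj.mono_right (Set.subset_sUnion_of_mem hD)⟩
      (Set.subset_insert C 𝒞) (Set.mem_insert C 𝒞)
    exact Set.disjoint_left.1 hCdisj hyC ⟨C, hC𝒞, hyC⟩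

theorem isOpenMap_domRestrict {B : Type*} {X : B → Type*} [∀ b, TopologicalSpace (X b)]
    (S : Set B) : IsOpenMap (S.domRestrict (π := X)) := by
  classical
  exact isOpenMap_fst.comp (Homeomorph.piEquivPiSubtypeProd (· ∈ S) X).isOpenMap

theorem measurableSet_closure_of_dependsOn {B : Type*} {X : B → Type*}
    [∀ b, TopologicalSpace (X b)] [∀ b, SecondCountableTopology (X b)]
    [∀ b, MeasurableSpace (X b)] [∀ b, BorelSpace (X b)] {V : Set (∀ b, X b)} {S : Set B}
    (hS : S.Countable) (hVS : DependsOn (· ∈ V) S) : MeasurableSet (closure V) := by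
  have hV : S.domRestrict ⁻¹' (S.domRestrict '' V) = V := by
    refine (Set.subset_preimage_image _ _).antisymm' ?_
    rintro x ⟨y, hy, hyx⟩
    exact (hVS fun b hb => congrFun hyx ⟨b, hb⟩).mp hy
  have := hS.to_subtype
  rw [← hV, ← (isOpenMap_domRestrict S).preimage_closure_eq_closure_preimage
    (Pi.continuous_domRestrict S)]
  exact Set.measurable_restrict S isClosed_closure.measurableSet

theorem measurableSet_closure_of_isOpen {B : Type*} {W : Set (B → ℝ)} (hW : IsOpen W) :
    MeasurableSet (closure W) := by
  let γ : Measure ℝ := ProbabilityTheory.gaussianReal 0 1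
  have : γ.IsOpenPosMeasure :=
    (ProbabilityTheory.gaussianReal_absolutelyContinuous' 0 one_ne_zero).isOpenPosMeasure
  have := isOpenPosMeasure_infinitePi fun _ : B => γ
  obtain ⟨𝒞, h𝒞, hcount, h𝒞W, hW𝒞⟩ := exists_countable_subset_closure_sUnion
    (Measure.infinitePi fun _ : B => γ) (isTopologicalBasis_pi fun _ => isTopologicalBasis_opens)
    (by
      rintro _ ⟨u, t, hu, rfl⟩
      exact .pi t.countable_toSet fun b hb => (hu b hb).out.measurableSet) hW
  choose u t _ hut using h𝒞
  rw [(closure_minimal hW𝒞 isClosed_closure).antisymm (closure_mono h𝒞W)]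
  refine measurableSet_closure_of_dependsOn (S := ⋃ C, ⋃ hC : C ∈ 𝒞, t hC)
    (hcount.biUnion fun C hC => (t hC).countable_toSet) fun x y hxy => ?_
  refine propext (exists_congr fun C => and_congr_right fun hC => ?_)
  rw [hut hC]
  refine forall₂_congr fun b hb => ?_
  rw [hxy b (Set.mem_iUnion₂.2 ⟨C, hC, hb⟩)]

theorem measurable_of_continuous_induced_of_denseRange {E Y : Type*} [TopologicalSpace Y]
    [MeasurableSpace Y] (hclosure : ∀ W : Set Y, IsOpen W → MeasurableSet (closure W))
    {Φ : E → Y} (hΦ : DenseRange Φ) {f : E → ℝ}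
    (hf : Continuous[.induced Φ inferInstance, inferInstance] f) :
    Measurable[MeasurableSpace.comap Φ inferInstance] f := by
  have hopen (O : Set ℝ) (hO : IsOpen O) : ∃ W, IsOpen W ∧ Φ ⁻¹' W = f ⁻¹' O :=
    isOpen_induced_iff.1 (continuous_def.1 hf O hO)
  choose W hW hWf using fun q : ℚ => hopen _ (isOpen_Iio (a := (q : ℝ)))
  have hle (q : ℚ) (x : E) (hx : Φ x ∈ closure (W q)) : f x ≤ q := by
    by_contra! hlt
    obtain ⟨W', hW', hW'f⟩ := hopen _ (isOpen_Ioi (a := (q : ℝ)))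
    have hxW' : Φ x ∈ W' := (Set.ext_iff.1 hW'f x).2 hlt
    obtain ⟨z, hzW', hzW⟩ := hΦ.exists_mem_open (hW'.inter (hW q))
      (mem_closure_iff.1 hx W' hW' hxW')
    have hzq : f z < q := (Set.ext_iff.1 (hWf q) z).1 hzW
    exact hzq.not_gt ((Set.ext_iff.1 hW'f z).1 hzW')
  let := MeasurableSpace.comap Φ inferInstance
  refine measurable_of_Iio fun p => ?_
  have hunion : f ⁻¹' Set.Iio p = ⋃ q ∈ {q : ℚ | (q : ℝ) < p}, Φ ⁻¹' closure (W q) := by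
    ext x
    simp only [Set.mem_preimage, Set.mem_Iio, Set.mem_iUnion, Set.mem_ofPred_eq, exists_prop]
    constructor
    · intro hx
      obtain ⟨q, hxq, hqp⟩ := exists_rat_btwn hx
      exact ⟨q, hqp, subset_closure ((Set.ext_iff.1 (hWf q) x).2 hxq)⟩
    · rintro ⟨q, hqp, hx⟩
      exact (hle q x hx).trans_lt hqp
  rw [hunion]
  exact .biUnion (Set.to_countable _) fun q _ => ⟨_, hclosure _ (hW q), rfl⟩

end WeaklyLindelof

section WeakBaire

theorem surjective_pi_of_linearIndependent {𝕜 V ι : Type*} [Field 𝕜] [AddCommGroup V]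
    [Module 𝕜 V] [Finite ι] {φ : ι → V →ₗ[𝕜] 𝕜} (hφ : LinearIndependent 𝕜 φ) :
    Function.Surjective (LinearMap.pi φ) := by
  classical
  have := Fintype.ofFinite ι
  rw [← LinearMap.dualMap_injective_iff, injective_iff_map_eq_zero]
  intro g hg
  have hcomb : ∑ i, g (Pi.single i 1) • φ i = 0 := by
    ext x
    have hx : g (LinearMap.pi φ x) = 0 := LinearMap.congr_fun hg x
    rw [LinearMap.pi_apply_eq_sum_univ g] at hx
    simpa [mul_comm, ← Pi.single_apply, Pi.single_comm, funext_iff] using hx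
  refine LinearMap.pi_ext' fun i => LinearMap.ext_ring ?_
  simpa using Fintype.linearIndependent_iff.1 hφ _ hcomb i

theorem denseRange_pi_of_linearIndependent {𝕜 V ι : Type*} [Field 𝕜] [TopologicalSpace 𝕜]
    [AddCommGroup V] [Module 𝕜 V] {φ : ι → V →ₗ[𝕜] 𝕜} (hφ : LinearIndependent 𝕜 φ) :
    DenseRange fun x i => φ i x := by
  refine dense_iff_inter_open.2 fun U hU => ?_
  rintro ⟨v, hv⟩
  obtain ⟨t, u, hu, huU⟩ := isOpen_pi_iff.1 hU v hv
  obtain ⟨x, hx⟩ := surjective_pi_of_linearIndependent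
    (hφ.comp (Subtype.val : t → ι) Subtype.val_injective) fun i => v i
  refine ⟨_, huU fun i hi => ?_, x, rfl⟩
  have hxi : φ i x = v i := congrFun hx ⟨i, hi⟩
  exact Set.mem_of_eq_of_mem hxi (hu i hi).2

theorem measurable_baireSigmaAlgebra {X : Type*} {t : TopologicalSpace X} {f : X → ℝ}
    (hf : Continuous[t, inferInstance] f) : Measurable[baireSigmaAlgebra t] f := by
  rw [measurable_iff_comap_le, BorelSpace.measurable_eq (α := ℝ)]
  exact le_iSup (fun f : {f : X → ℝ // Continuous[t, inferInstance] f} =>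
    MeasurableSpace.comap f.1 (borel ℝ)) ⟨f, hf⟩

variable {E : Type*} [AddCommGroup E] [Module ℝ E] [TopologicalSpace E]

theorem continuous_induced_toWeakSpace (φ : E →L[ℝ] ℝ) :
    Continuous[.induced (toWeakSpace ℝ E) inferInstance, inferInstance] φ :=
  @Continuous.comp _ (WeakSpace ℝ E) _ (_) _ _ (toWeakSpace ℝ E) _
    (WeakBilin.eval_continuous (topDualPairing ℝ E).flip φ) continuous_induced_dom

theorem induced_basis_le_induced_toWeakSpace {ι : Type*} (b : Module.Basis ι ℝ (E →L[ℝ] ℝ)) :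
    TopologicalSpace.induced (fun x i => b i x) Pi.topologicalSpace ≤
      .induced (toWeakSpace ℝ E) inferInstance := by
  let : TopologicalSpace E := .induced (fun x i => b i x) Pi.topologicalSpace
  rw [← continuous_iff_le_induced]
  refine WeakBilin.continuous_of_continuous_eval _ fun φ => ?_
  change Continuous fun x : E => φ x
  have hcoord (i : ι) : Continuous fun x => b i x :=
    (continuous_apply i).comp (continuous_induced_dom (f := fun x i => b i x))
  have hsum (x : E) : φ x = ∑ i ∈ (b.repr φ).support, b.repr φ i * b i x := by
    conv_lhs => rw [← b.linearCombination_repr φ]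
    simp [Finsupp.linearCombination_apply, Finsupp.sum]
  simp_rw [hsum]
  exact continuous_finsetSum _ fun i _ => continuous_const.mul (hcoord i)

theorem baireSigmaAlgebra_weak_le :
    baireSigmaAlgebra (.induced (toWeakSpace ℝ E) inferInstance) ≤
      ⨆ φ : E →L[ℝ] ℝ, MeasurableSpace.comap φ inferInstance := by
  refine iSup_le fun ⟨f, hf⟩ => ?_
  let b := Module.Basis.ofVectorSpace ℝ (E →L[ℝ] ℝ)
  have hlin : LinearIndependent ℝ fun i => (b i : E →ₗ[ℝ] ℝ) :=
    b.linearIndependent.map' (ContinuousLinearMap.coeLM ℝ)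
      (LinearMap.ker_eq_bot.2 ContinuousLinearMap.coe_injective)
  have hmeas := measurable_of_continuous_induced_of_denseRange
    (fun _ => measurableSet_closure_of_isOpen) (denseRange_pi_of_linearIndependent hlin)
    (continuous_le_dom (induced_basis_le_induced_toWeakSpace b) hf)
  rw [← BorelSpace.measurable_eq (α := ℝ)]
  refine hmeas.comap_le.trans ?_
  simp only [MeasurableSpace.pi, MeasurableSpace.comap_iSup, MeasurableSpace.comap_comp]
  exact iSup_le fun i => le_iSup (fun φ : E →L[ℝ] ℝ => MeasurableSpace.comap φ _) (b i)

end WeakBaire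

/-! ### Functionals on `C(βα)` and almost disjoint families -/

section BetaIndicator

variable {α : Type*}

theorem isClopen_setOf_mem_ultrafilter (A : Set α) : IsClopen {F : Ultrafilter α | A ∈ F} :=
  ⟨ultrafilter_isClosed_basic A, ultrafilter_isOpen_basic A⟩

/-- The continuous extension to `βα` of the indicator function of `A ⊆ α`. -/
noncomputable def betaIndicator (A : Set α) : C(Ultrafilter α, ℝ) :=
  (LocallyConstant.charFn ℝ (isClopen_setOf_mem_ultrafilter A)).toContinuousMap

open Classical in
theorem betaIndicator_apply (A : Set α) (F : Ultrafilter α) :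
    betaIndicator A F = if A ∈ F then 1 else 0 := by
  change LocallyConstant.charFn ℝ (isClopen_setOf_mem_ultrafilter A) F = _
  rw [LocallyConstant.coe_charFn, Set.indicator_apply]
  rfl

theorem disjoint_notMem_ultrafilter {A B : Set α} (h : Disjoint A B) {F : Ultrafilter α}
    (hA : A ∈ F) : B ∉ F := fun hB =>
  F.empty_notMem (Set.disjoint_iff_inter_eq_empty.1 h ▸ Filter.inter_mem hA hB)

theorem betaIndicator_union {A B : Set α} (h : Disjoint A B) :
    betaIndicator (A ∪ B) = betaIndicator A + betaIndicator B := by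
  ext F
  have hunion : A ∪ B ∈ F ↔ A ∈ F ∨ B ∈ F := Ultrafilter.union_mem_iff
  rw [ContinuousMap.add_apply]
  by_cases hA : A ∈ F
  · simp [betaIndicator_apply, hunion, hA, disjoint_notMem_ultrafilter h hA]
  · by_cases hB : B ∈ F <;> simp [betaIndicator_apply, hunion, hA, hB]

theorem betaIndicator_sdiff_add_inter (A B : Set α) :
    betaIndicator (A \ B) + betaIndicator (A ∩ B) = betaIndicator A := by
  rw [← betaIndicator_union Set.disjoint_sdiff_inter, Set.sdiff_union_inter]

theorem betaIndicator_apply_of_finite {B : Set α} (hB : B.Finite) {F : Ultrafilter α}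
    (hF : (F : Filter α) ≤ Filter.cofinite) : betaIndicator B F = 0 := by
  rw [betaIndicator_apply, if_neg (Ultrafilter.compl_mem_iff_notMem.1 (hF hB.compl_mem_cofinite))]

theorem mem_omegaStar_iff {F : BetaOmega} : F ∈ omegaStar ↔ (F : Filter ℕ) ≤ Filter.cofinite := by
  refine ⟨fun hF => F.le_cofinite_or_eq_pure.resolve_right ?_, ?_⟩
  · rintro ⟨n, hn⟩
    exact hF ⟨n, hn.symm⟩
  · rintro hF ⟨n, rfl⟩
    exact hF (Set.finite_singleton n).compl_mem_cofinite rfl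

theorem sum_abs_apply_le_norm {K ι : Type*} [TopologicalSpace K] [CompactSpace K]
    (φ : C(K, ℝ) →L[ℝ] ℝ) (T : Finset ι) (f : ι → C(K, ℝ)) (hf : ∀ x, ∑ i ∈ T, |f i x| ≤ 1) :
    ∑ i ∈ T, |φ (f i)| ≤ ‖φ‖ := by
  let s (i : ι) : ℝ := SignType.sign (φ (f i))
  have hs (i : ι) : |s i| ≤ 1 := by
    rcases h : SignType.sign (φ (f i)) with _ | _ | _ <;> simp [s, h]
  have hg : ‖∑ i ∈ T, s i • f i‖ ≤ 1 := by
    refine (ContinuousMap.norm_le _ zero_le_one).2 fun x => ?_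
    rw [ContinuousMap.coe_sum, Finset.sum_apply]
    refine (Finset.abs_sum_le_sum_abs _ _).trans ((Finset.sum_le_sum fun i _ => ?_).trans (hf x))
    rw [ContinuousMap.smul_apply, smul_eq_mul, abs_mul]
    exact mul_le_of_le_one_left (abs_nonneg _) (hs i)
  calc ∑ i ∈ T, |φ (f i)| = φ (∑ i ∈ T, s i • f i) := by
        simp only [map_sum, map_smul, smul_eq_mul, s, sign_mul_self]
    _ ≤ ‖φ‖ * ‖∑ i ∈ T, s i • f i‖ := (Real.le_norm_self _).trans (φ.le_opNorm _)
    _ ≤ ‖φ‖ := mul_le_of_le_one_right φ.opNorm_nonneg hg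

theorem card_mul_le_norm {ι : Type*} (φ : C(Ultrafilter α, ℝ) →L[ℝ] ℝ) {T : Finset ι}
    {P : ι → Set α} (hP : (T : Set ι).PairwiseDisjoint P) {ε : ℝ}
    (hε : ∀ i ∈ T, ε ≤ |φ (betaIndicator (P i))|) : T.card * ε ≤ ‖φ‖ := by
  rw [← nsmul_eq_mul]
  refine (Finset.card_nsmul_le_sum _ _ _ hε).trans (sum_abs_apply_le_norm φ T _ fun F => ?_)
  simp only [betaIndicator_apply, apply_ite abs, abs_one, abs_zero]
  by_cases h : ∃ i ∈ T, P i ∈ F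
  · obtain ⟨i, hi, hiF⟩ := h
    rw [Finset.sum_eq_single_of_mem i hi fun j hj hji =>
      if_neg (disjoint_notMem_ultrafilter (hP hi hj hji.symm) hiF), if_pos hiF]
  · push Not at h
    rw [Finset.sum_eq_zero fun i hi => if_neg (h i hi)]
    exact zero_le_one

end BetaIndicator

section AlmostDisjoint

open Filter

variable {α ι : Type*} {A : ι → Set α}

instance countableInterFilter_cocountable : CountableInterFilter (cocountable : Filter ι) :=
  cardinalInterFilter_aleph_one_iff.1 inferInstance

instance neBot_cocountable [Uncountable ι] : (cocountable : Filter ι).NeBot :=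
  ⟨fun h => Set.not_countable_univ (α := ι)
    (Set.compl_empty ▸ mem_cocountable.1 (Filter.empty_mem_iff_bot.2 h))⟩

theorem finite_setOf_frequently_le_abs (hA : Pairwise fun i j => (A i ∩ A j).Finite)
    (φ : C(Ultrafilter α, ℝ) →L[ℝ] ℝ) {ε : ℝ} (hε : 0 < ε) :
    {i | ∃ B ⊆ A i, ∃ᶠ T : Finset α in atTop, ε ≤ |φ (betaIndicator (B \ T))|}.Finite := by
  by_contra hinf
  obtain ⟨M, hM⟩ := exists_nat_gt (‖φ‖ / ε)
  obtain ⟨I, hI, hIM⟩ := Set.Infinite.exists_subset_card_eq hinf M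
  have hfin : (⋃ p ∈ (I ×ˢ I : Finset (ι × ι)), {a ∈ A p.1 ∩ A p.2 | p.1 ≠ p.2}).Finite := by
    refine (I ×ˢ I).finite_toSet.biUnion fun p _ => ?_
    by_cases hp : p.1 = p.2
    · simp [hp]
    · exact (hA hp).subset (Set.sep_subset _ _)
  have hlarge : ∀ i ∈ I, ∃ B ⊆ A i, ∃ T ≥ hfin.toFinset, ε ≤ |φ (betaIndicator (B \ T))| :=
    fun i hi => (hI hi).imp fun B hB => hB.imp_right fun h => h.forall_exists_of_atTop _
  choose! B hBA T hT hBT using hlarge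
  have hdisj : (I : Set ι).PairwiseDisjoint fun i => B i \ T i := by
    refine fun i hi j hj hij => Set.disjoint_left.2 fun a ha ha' => ha.2 (hT i hi ?_)
    exact hfin.mem_toFinset.2 (Set.mem_biUnion (x := (i, j)) (Finset.mk_mem_product hi hj)
      ⟨⟨hBA i hi ha.1, hBA j hj ha'.1⟩, hij⟩)
  have hcard := card_mul_le_norm φ hdisj hBT
  rw [hIM, ← le_div_iff₀ hε] at hcard
  exact hcard.not_gt hM

theorem eventually_cocountable_tendsto (hA : Pairwise fun i j => (A i ∩ A j).Finite)
    (φ : C(Ultrafilter α, ℝ) →L[ℝ] ℝ) : ∀ᶠ i in cocountable, ∀ B ⊆ A i,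
      Tendsto (fun T : Finset α => φ (betaIndicator (B ∩ T))) atTop (𝓝 (φ (betaIndicator B))) := by
  have hsmall (m : ℕ) := mem_cocountable.2
    ((finite_setOf_frequently_le_abs hA φ (Nat.one_div_pos_of_nat (n := m))).countable.mono
      (compl_compl _).subset)
  filter_upwards [eventually_countable_forall.2 hsmall] with i hi B hB
  refine Metric.tendsto_nhds.2 fun ε hε => ?_
  obtain ⟨m, hm⟩ := exists_nat_one_div_lt hε
  have hev : ∀ᶠ T : Finset α in atTop, |φ (betaIndicator (B \ T))| < 1 / ((m : ℝ) + 1) := by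
    have h := hi m
    simp only [not_exists, not_and, not_frequently, not_le] at h
    exact h B hB
  filter_upwards [hev] with T hT
  rw [dist_comm, Real.dist_eq, ← betaIndicator_sdiff_add_inter B T, map_add, add_sub_cancel_right]
  exact hT.trans hm

theorem measurable_of_dependsOn_finset {J β : Type*} [MeasurableSpace β] [Nonempty β]
    {f : (J → Bool) → β} {s : Finset J} (hf : DependsOn f s) : Measurable f := by
  obtain ⟨g, rfl⟩ := dependsOn_iff_exists_comp.1 hf
  exact (Measurable.of_discrete (f := g)).comp (Set.measurable_restrict _)

theorem measurable_betaIndicator_codedSet [Countable α] {N : Set α}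
    {φ : C(Ultrafilter α, ℝ) →L[ℝ] ℝ} (hφ : ∀ B ⊆ N,
      Tendsto (fun T : Finset α => φ (betaIndicator (B ∩ T))) atTop (𝓝 (φ (betaIndicator B)))) :
    Measurable fun x : N → Bool => φ (betaIndicator (codedSet x)) := by
  classical
  refine measurable_of_tendsto_metrizable' atTop (fun T => ?_)
    (tendsto_pi_nhds.2 fun x => hφ _ (codedSet_subset x))
  refine measurable_of_dependsOn_finset (s := T.subtype (· ∈ N)) fun x y hxy => ?_
  congr 2
  ext a
  refine and_congr_left fun haT => ?_
  by_cases haN : a ∈ N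
  · rw [mem_codedSet_iff haN, mem_codedSet_iff haN, hxy ⟨a, haN⟩ (by simpa using haT)]
  · exact iff_of_false (fun h => haN (codedSet_subset x h)) fun h => haN (codedSet_subset y h)

/-- The σ-algebra of the sets whose preimages under `κ i` are measurable for `l`-almost all `i`. -/
@[reducible] def eventuallyMeasurable {X : Type*} {Y : ι → Type*} [∀ i, MeasurableSpace (Y i)]
    (l : Filter ι) [CountableInterFilter l] (κ : ∀ i, Y i → X) : MeasurableSpace X where
  MeasurableSet' s := ∀ᶠ i in l, MeasurableSet (κ i ⁻¹' s)
  measurableSet_empty := .of_forall fun _ => .empty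
  measurableSet_compl _ hs := hs.mono fun _ => .compl
  measurableSet_iUnion s hs := by
    filter_upwards [eventually_countable_forall.2 hs] with i hi
    rw [Set.preimage_iUnion]
    exact .iUnion hi

theorem baireSigmaAlgebra_weak_le_eventuallyMeasurable [Countable α]
    (hA : Pairwise fun i j => (A i ∩ A j).Finite) :
    baireSigmaAlgebra (weakTopology (Ultrafilter α)) ≤
      eventuallyMeasurable cocountable fun i (x : A i → Bool) => betaIndicator (codedSet x) := by
  refine baireSigmaAlgebra_weak_le.trans (iSup_le fun φ => ?_)
  rintro _ ⟨s, hs, rfl⟩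
  filter_upwards [eventually_cocountable_tendsto hA φ] with i hi
  exact measurable_betaIndicator_codedSet hi hs

theorem not_measurableSet_codedSet_mem {N : Set α} {F : Ultrafilter α}
    (hF : (F : Filter α) ≤ cofinite) (hN : N ∈ F) :
    ¬ MeasurableSet {x : N → Bool | codedSet x ∈ F} := by
  classical
  intro hmeas
  have hzero := eq_zero_of_additive_of_measurable (ν := fun B => betaIndicator B F) (N := N)
    (fun B C hBC => by rw [betaIndicator_union hBC, ContinuousMap.add_apply])
    (fun B hB => betaIndicator_apply_of_finite hB hF)
    (by
      simp only [betaIndicator_apply]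
      exact .ite hmeas measurable_const measurable_const)
  simp only [betaIndicator_apply, if_pos hN, one_ne_zero] at hzero

end AlmostDisjoint

section PositiveSomewhere

variable {ι : Type*}

theorem betaIndicator_codedSet_mem_positiveSomewhere {A : ι → Set ℕ} {F : ι → BetaOmega}
    (hA : Pairwise fun i j => (A i ∩ A j).Finite) (hF : ∀ i, (F i : Filter ℕ) ≤ Filter.cofinite)
    (hAF : ∀ i, A i ∈ F i) {i : ι} (x : A i → Bool) :
    betaIndicator (codedSet x) ∈ positiveSomewhere F ↔ codedSet x ∈ F i := by
  have hpos (j : ι) : 0 < betaIndicator (codedSet x) (F j) ↔ codedSet x ∈ F j := by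
    rw [betaIndicator_apply]
    split_ifs with h <;> simp [h]
  refine (exists_congr hpos).trans ⟨fun ⟨j, hj⟩ => ?_, fun h => ⟨i, h⟩⟩
  by_contra hi
  have hij : i ≠ j := fun h => hi (h ▸ hj)
  exact Ultrafilter.compl_mem_iff_notMem.1 (hF j (hA hij).compl_mem_cofinite)
    (Filter.inter_mem (Filter.mem_of_superset hj (codedSet_subset x)) (hAF j))

theorem not_measurableSet_positiveSomewhere [Uncountable ι] {A : ι → Set ℕ} {F : ι → BetaOmega}
    (hA : IsAlmostDisjointFamily A) (hF : ∀ i, F i ∈ omegaStar) (hAF : ∀ i, A i ∈ F i) :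
    ¬ MeasurableSet[baireSigmaAlgebra (weakTopology BetaOmega)] (positiveSomewhere F) := by
  intro hV
  have hfin : Pairwise fun i j => (A i ∩ A j).Finite := fun i j => hA.2 i j
  have hcof (i : ι) := mem_omegaStar_iff.1 (hF i)
  obtain ⟨i, hi⟩ := Filter.Eventually.exists (f := Filter.cocountable)
    (baireSigmaAlgebra_weak_le_eventuallyMeasurable hfin _ hV)
  refine not_measurableSet_codedSet_mem (hcof i) (hAF i) ?_
  simpa only [Set.preimage, betaIndicator_codedSet_mem_positiveSomewhere hfin hcof hAF] using hi

theorem isOpen_positiveSomewhere (F : ι → BetaOmega) :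
    IsOpen[pointwiseTopology BetaOmega] (positiveSomewhere F) := by
  refine isOpen_induced_iff.2 ⟨⋃ i, (fun g : BetaOmega → ℝ => g (F i)) ⁻¹' Set.Ioi 0,
    isOpen_iUnion fun i => isOpen_Ioi.preimage (continuous_apply _), ?_⟩
  ext f
  simp [positiveSomewhere]

theorem exists_mem_omegaStar {A : Set ℕ} (hA : A.Infinite) : ∃ F ∈ omegaStar, A ∈ F := by
  have := hA.cofinite_inf_principal_neBot
  obtain ⟨F, hF⟩ := Ultrafilter.exists_le (Filter.cofinite ⊓ Filter.principal A)
  exact ⟨F, mem_omegaStar_iff.2 (hF.trans inf_le_left),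
    Filter.le_principal_iff.1 (hF.trans inf_le_right)⟩

/-- The branches of the binary tree `2^{<ω}`, as sets of codes of their nodes. -/
theorem isAlmostDisjointFamily_branches :
    IsAlmostDisjointFamily fun x : ℕ → Bool =>
      Set.range fun n => Encodable.encode ((List.range n).map x) := by
  refine ⟨fun x => Set.infinite_range_of_injective fun m n h => ?_, fun x y hxy => ?_⟩
  · simpa using congrArg List.length (Encodable.encode_injective h)
  · obtain ⟨k, hk⟩ := Function.ne_iff.1 hxy
    refine ((Set.finite_Iic k).image fun n => Encodable.encode ((List.range n).map x)).subset ?_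
    rintro _ ⟨⟨n, rfl⟩, m, hm⟩
    refine ⟨n, Set.mem_Iic.2 (le_of_not_gt fun hkn => hk ?_), rfl⟩
    have hmap := Encodable.encode_injective hm
    obtain rfl : m = n := by simpa using congrArg List.length hmap
    exact (List.map_inj_left.1 hmap k (List.mem_range.2 hkn)).symm

theorem not_borel_pointwise_le_baire_weak :
    ¬ borelSigmaAlgebra (pointwiseTopology BetaOmega) ≤
        baireSigmaAlgebra (weakTopology BetaOmega) := by
  intro h
  have hA := isAlmostDisjointFamily_branches
  choose F hF hAF using fun x => exists_mem_omegaStar (hA.1 x)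
  have : Uncountable (ℕ → Bool) := Cardinal.aleph0_lt_mk_iff.1 (by
    simpa using Cardinal.cantor Cardinal.aleph0)
  exact not_measurableSet_positiveSomewhere hA hF hAF
    (h _ (MeasurableSpace.measurableSet_generateFrom (isOpen_positiveSomewhere F)))

end PositiveSomewhere

/-! ### Generating open sets of a Borel map -/

section BorelGenerated

open MeasurableSpace

theorem exists_countable_measurableSet_generateFrom {X : Type*} {G : Set (Set X)} {s : Set X}
    (hs : MeasurableSet[generateFrom G] s) :
    ∃ C ⊆ G, C.Countable ∧ MeasurableSet[generateFrom C] s := by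
  induction hs with
  | basic u hu => exact ⟨{u}, Set.singleton_subset_iff.2 hu, Set.countable_singleton u,
      measurableSet_generateFrom rfl⟩
  | empty => exact ⟨∅, G.empty_subset, Set.countable_empty, @MeasurableSet.empty _ (_)⟩
  | compl t _ ih =>
    obtain ⟨C, hCG, hC, ht⟩ := ih
    exact ⟨C, hCG, hC, ht.compl⟩
  | iUnion f _ ih =>
    choose C hCG hC hf using ih
    exact ⟨⋃ n, C n, Set.iUnion_subset hCG, Set.countable_iUnion hC,
      @MeasurableSet.iUnion _ _ (generateFrom _) _ _ fun n =>
        generateFrom_mono (Set.subset_iUnion C n) _ (hf n)⟩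

theorem exists_countable_measurable_generateFrom {X Y : Type*} [m : MeasurableSpace Y]
    [CountablyGenerated Y] {G : Set (Set X)} {f : X → Y} (hf : Measurable[generateFrom G] f) :
    ∃ C ⊆ G, C.Countable ∧ Measurable[generateFrom C] f := by
  obtain ⟨b, hb, rfl⟩ := CountablyGenerated.isCountablyGenerated (α := Y)
  choose! C hCG hC hf using fun s (hs : s ∈ b) =>
    exists_countable_measurableSet_generateFrom (hf (measurableSet_generateFrom hs))
  refine ⟨⋃ s ∈ b, C s, Set.iUnion₂_subset hCG, hb.biUnion hC, ?_⟩
  exact @measurable_generateFrom _ _ (_) _ _ fun s hs =>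
    generateFrom_mono (Set.subset_biUnion_of_mem hs) _ (hf s hs)

theorem exists_seq_isOpen_measurable {X Y : Type*} [MeasurableSpace Y] [CountablyGenerated Y]
    {t : TopologicalSpace X} {f : X → Y} (hf : Measurable[borelSigmaAlgebra t] f) :
    ∃ U : ℕ → Set X, (∀ n, IsOpen (U n)) ∧ Measurable[generateFrom (Set.range U)] f := by
  obtain ⟨C, hC, hcount, hfC⟩ := exists_countable_measurable_generateFrom hf
  obtain ⟨U, hU⟩ := (hcount.insert ∅).exists_eq_range (Set.insert_nonempty _ _)
  refine ⟨U, fun n => ?_, hfC.mono (generateFrom_mono (hU ▸ Set.subset_insert ∅ C)) le_rfl⟩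
  rcases hU ▸ Set.mem_range_self n with hn | hn
  · exact hn ▸ isOpen_empty
  · exact hC hn

end BorelGenerated

/-! ### Cells of sets -/

section Cell

variable {α : Type*} {A A' B N N' : Set α}

/-- The sets that agree with `A` outside `N`. The pair `(A, N)` is a Silver forcing condition, and
its cell consists of the sets compatible with it. -/
def cell (A N : Set α) : Set (Set α) :=
  {B | ∀ a ∉ N, a ∈ B ↔ a ∈ A}

theorem self_mem_cell (A N : Set α) : A ∈ cell A N := fun _ _ => Iff.rfl

theorem cell_subset_cell (hA : A' ∈ cell A N) (hN : N' ⊆ N) : cell A' N' ⊆ cell A N :=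
  fun _ hB a ha => (hB a fun h => ha (hN h)).trans (hA a ha)

theorem inter_eq_iff_mem_cell_compl : A ∩ N = B ∩ N ↔ A ∈ cell B Nᶜ := by
  simp only [Set.ext_iff, Set.mem_inter_iff, and_congr_left_iff, cell, Set.mem_ofPred_eq,
    Set.notMem_compl_iff]

theorem exists_forall_mem_cell {A N : ℕ → Set α} (hN : ∀ i, N (i + 1) ⊆ N i)
    (hA : ∀ i, A (i + 1) ∈ cell (A i) (N i)) : ∃ A', ∀ i, A' ∈ cell (A i) (N i) := by
  have hanti : Antitone N := antitone_nat_of_succ_le hN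
  have hcell : ∀ i j, i ≤ j → A j ∈ cell (A i) (N i) := by
    intro i j hij
    induction j, hij using Nat.le_induction with
    | base => exact self_mem_cell _ _
    | succ j hij ih => exact cell_subset_cell ih (hanti hij) (hA j)
  refine ⟨{a | ∃ i, a ∉ N i ∧ a ∈ A i}, fun i a hi => ⟨?_, fun ha => ⟨i, hi, ha⟩⟩⟩
  rintro ⟨j, hj, ha⟩
  rcases le_total i j with hij | hji
  · exact (hcell i j hij a hi).1 ha
  · exact (hcell j i hji a hj).2 ha

/-- The set that agrees with `A` outside `N` and with the set coded by `x` on `N`. -/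
def graft (A : Set α) (x : N → Bool) : Set α :=
  A \ N ∪ codedSet x

theorem mem_graft_of_mem {a : α} (ha : a ∈ N) (A : Set α) (x : N → Bool) :
    a ∈ graft A x ↔ x ⟨a, ha⟩ = true := by
  simp [graft, ha, mem_codedSet_iff ha]

theorem graft_mem_cell (A : Set α) (x : N → Bool) : graft A x ∈ cell A N := fun a ha => by
  have hax : a ∉ codedSet x := fun h => ha (codedSet_subset x h)
  simp [graft, ha, hax]

theorem isOpen_preimage_graft {𝒰 : Set (Set α)} (h𝒰 : ∀ B ∈ cell A N, B ∈ 𝒰 →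
    ∃ D : Finset α, ∀ B' ∈ cell A N, B' ∈ cell B (↑D)ᶜ → B' ∈ 𝒰) :
    IsOpen ((graft A : (N → Bool) → Set α) ⁻¹' 𝒰) := by
  classical
  refine isOpen_pi_iff.2 fun x hx => ?_
  obtain ⟨D, hD⟩ := h𝒰 _ (graft_mem_cell A x) hx
  refine ⟨D.subtype (· ∈ N), fun i => {x i}, fun i _ => ⟨isOpen_discrete _, rfl⟩, fun y hy =>
    hD _ (graft_mem_cell A y) fun a ha => ?_⟩
  by_cases haN : a ∈ N
  · have hya : y ⟨a, haN⟩ = x ⟨a, haN⟩ := hy ⟨a, haN⟩ (by simpa using ha)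
    rw [mem_graft_of_mem haN, mem_graft_of_mem haN, hya]
  · rw [graft_mem_cell A y a haN, graft_mem_cell A x a haN]

end Cell

/-! ### Pointwise Borel sets and the asymptotic density -/

section Diffuse

open MeasureTheory

variable {α : Type*} {m : OuterMeasure α}

/-- An outer measure is diffuse if every free ultrafilter contains sets of arbitrarily small outer
measure. -/
def IsDiffuse (m : OuterMeasure α) : Prop :=
  ∀ F : Ultrafilter α, (F : Filter α) ≤ Filter.cofinite → ∀ ε ≠ 0, ∃ E ∈ F, m E ≤ ε

theorem IsDiffuse.exists_forall_mem (hm : IsDiffuse m) {T : Finset (Ultrafilter α)}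
    (hT : ∀ F ∈ T, (F : Filter α) ≤ Filter.cofinite) {ε : ENNReal} (hε : ε ≠ 0) :
    ∃ E, m E ≤ ε ∧ ∀ F ∈ T, E ∈ F := by
  choose! E hEF hE using fun F hF =>
    hm F (hT F hF) (ε / T.card) (ENNReal.div_ne_zero.2 ⟨hε, ENNReal.natCast_ne_top _⟩)
  refine ⟨⋃ F ∈ T, E F, ?_, fun F hF =>
    Filter.mem_of_superset (hEF F hF) (Set.subset_biUnion_of_mem hF)⟩
  calc m (⋃ F ∈ T, E F) ≤ ∑ F ∈ T, m (E F) := measure_biUnion_finset_le T E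
    _ ≤ T.card • (ε / T.card) := Finset.sum_le_card_nsmul _ _ _ hE
    _ ≤ ε := by rw [nsmul_eq_mul]; exact ENNReal.mul_div_le

/-- The sets all of whose modifications outside `D` and outside a suitable set of arbitrarily small
outer measure belong to `𝒰`. -/
def diffuseInterior (m : OuterMeasure α) (𝒰 : Set (Set α)) (D : Set α) : Set (Set α) :=
  {A | ∀ ε ≠ 0, ∃ E, m E ≤ ε ∧ cell A (D ∪ E)ᶜ ⊆ 𝒰}

theorem mem_ultrafilter_iff_of_mem_cell {A B S : Set α} {F : Ultrafilter α} (hS : S ∈ F)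
    (hB : B ∈ cell A Sᶜ) : B ∈ F ↔ A ∈ F := by
  have hBA : B ∩ S = A ∩ S := inter_eq_iff_mem_cell_compl.2 hB
  calc B ∈ F ↔ B ∩ S ∈ F := (Filter.inter_mem_iff.trans (and_iff_left hS)).symm
    _ ↔ A ∈ F := by rw [hBA]; exact Filter.inter_mem_iff.trans (and_iff_left hS)

theorem exists_mem_diffuseInterior (hm : IsDiffuse m) {U : Set C(Ultrafilter α, ℝ)}
    (hU : IsOpen[pointwiseTopology (Ultrafilter α)] U) {A : Set α} (hA : betaIndicator A ∈ U) :
    ∃ D : Finset α, A ∈ diffuseInterior m (betaIndicator ⁻¹' U) D := by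
  classical
  obtain ⟨W, hW, rfl⟩ := isOpen_induced_iff.1 hU
  obtain ⟨I, u, hu, huW⟩ := isOpen_pi_iff.1 hW _ hA
  refine ⟨I.preimage pure Ultrafilter.pure_injective.injOn, fun ε hε => ?_⟩
  obtain ⟨E, hE, hEI⟩ := hm.exists_forall_mem
    (T := I.filter fun F => (F : Filter α) ≤ Filter.cofinite) (by simp) hε
  refine ⟨E, hE, fun B hB => huW fun F hF => ?_⟩
  have hFDE : ↑(I.preimage pure Ultrafilter.pure_injective.injOn) ∪ E ∈ F := by
    rcases F.le_cofinite_or_eq_pure with hfree | ⟨a, rfl⟩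
    · exact Filter.mem_of_superset (hEI F (Finset.mem_filter.2 ⟨hF, hfree⟩))
        Set.subset_union_right
    · exact .inl (Finset.mem_coe.2 (Finset.mem_preimage.2 hF))
  have hBA : betaIndicator B F = betaIndicator A F := by
    simp only [betaIndicator_apply, mem_ultrafilter_iff_of_mem_cell hFDE hB]
  exact Set.mem_of_eq_of_mem hBA (hu F hF).2

theorem exists_cell_subset_of_mem_diffuseInterior (m : OuterMeasure α) (𝒰 : Set (Set α))
    (D τ : Set α) {ε : ENNReal} (hε : ε ≠ 0) (A N : Set α) :
    ∃ A' ∈ cell A N, ∃ N' ⊆ N, m (N \ N') ≤ ε ∧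
      ∀ B ∈ cell A' N', B ∩ D = τ → B ∈ diffuseInterior m 𝒰 D →
        ∀ B' ∈ cell A' N', B' ∩ D = τ → B' ∈ 𝒰 := by
  by_cases h : ∃ B ∈ cell A N, B ∩ D = τ ∧ B ∈ diffuseInterior m 𝒰 D
  · obtain ⟨B, hBN, hBτ, hB⟩ := h
    obtain ⟨E, hE, hE𝒰⟩ := hB ε hε
    have hdiff : N \ (N \ (E \ D)) ⊆ E := Set.sdiff_subset_comm.1 (by grind)
    refine ⟨B, hBN, N \ (E \ D), Set.sdiff_subset, (m.mono hdiff).trans hE,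
      fun _ _ _ _ B' hB' hB'τ => hE𝒰 fun a ha => ?_⟩
    by_cases haD : a ∈ D
    · exact inter_eq_iff_mem_cell_compl.1 (hB'τ.trans hBτ.symm) a (Set.notMem_compl_iff.2 haD)
    · exact hB' a fun h => h.2 ⟨(Set.notMem_compl_iff.1 ha).resolve_left haD, haD⟩
  · refine ⟨A, self_mem_cell A N, N, subset_rfl, by simp, fun B hBN hBτ hB => ?_⟩
    exact absurd ⟨B, hBN, hBτ, hB⟩ h

/-- Fusion: the conditions of a decreasing sequence take care of the triples `(n, D, τ)` one by one,
and lose only a summable amount of outer measure. -/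
theorem exists_isOpen_preimage_graft_of_diffuseInterior [Countable α] {𝒰 : ℕ → Set (Set α)}
    (h𝒰 : ∀ n, ∀ A ∈ 𝒰 n, ∃ D : Finset α, A ∈ diffuseInterior m (𝒰 n) D) {ε : ENNReal}
    (hε : ε ≠ 0) : ∃ A N : Set α, m Nᶜ ≤ ε ∧
      ∀ n, IsOpen ((graft A : (N → Bool) → Set α) ⁻¹' 𝒰 n) := by
  obtain ⟨c, hc⟩ := exists_surjective_nat (ℕ × Finset α × Finset α)
  obtain ⟨δ, hδ, hδε⟩ := ENNReal.exists_pos_sum_of_countable' hε ℕ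
  choose nextA hnextA nextN hnextN hδN hdecide using fun i (p : Set α × Set α) =>
    exists_cell_subset_of_mem_diffuseInterior m (𝒰 (c i).1) (c i).2.1 (c i).2.2 (hδ i).ne' p.1 p.2
  let p (i : ℕ) : Set α × Set α := Nat.rec (∅, Set.univ) (fun i p => (nextA i p, nextN i p)) i
  obtain ⟨A, hA⟩ := exists_forall_mem_cell (A := fun i => (p i).1) (N := fun i => (p i).2)
    (fun i => hnextN i (p i)) fun i => hnextA i (p i)
  refine ⟨A, ⋂ i, (p i).2, ?_, fun n => isOpen_preimage_graft fun B hB hBn => ?_⟩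
  · have hcover : (⋂ i, (p i).2)ᶜ ⊆ ⋃ i, (p i).2 \ (p (i + 1)).2 := by
      intro a ha
      by_contra hno
      simp only [Set.mem_iUnion, Set.mem_sdiff, not_exists, not_and, not_not] at hno
      exact ha (Set.mem_iInter.2 fun i => Nat.rec (Set.mem_univ a) hno i)
    calc m (⋂ i, (p i).2)ᶜ ≤ ∑' i, m ((p i).2 \ (p (i + 1)).2) :=
          (m.mono hcover).trans (measure_iUnion_le _)
      _ ≤ ∑' i, δ i := ENNReal.tsum_le_tsum fun i => hδN i (p i)
      _ ≤ ε := hδε.le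
  · obtain ⟨D, hD⟩ := h𝒰 n B hBn
    obtain ⟨τ, hτ⟩ := (D.finite_toSet.subset (Set.inter_subset_right (s := B))).exists_finset_coe
    obtain ⟨i, hi⟩ := hc (n, D, τ)
    have hdecide := hdecide i (p i)
    rw [hi] at hdecide
    have hsub : cell A (⋂ i, (p i).2) ⊆ cell (p (i + 1)).1 (p (i + 1)).2 :=
      cell_subset_cell (hA (i + 1)) (Set.iInter_subset (fun j => (p j).2) (i + 1))
    exact ⟨D, fun B' hB' hB'D => hdecide B (hsub hB) hτ.symm hD B' (hsub hB')
      ((inter_eq_iff_mem_cell_compl.2 hB'D).trans hτ.symm)⟩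

end Diffuse

section Density

open MeasureTheory Filter ProbabilityTheory

theorem exists_tendsto_of_norm_le {E ι : Type*} [SeminormedAddCommGroup E] [NormedSpace ℝ E]
    (l : Ultrafilter ι) {L : ι → E →L[ℝ] ℝ} {r : ℝ} (hL : ∀ i, ‖L i‖ ≤ r) :
    ∃ Λ : E →L[ℝ] ℝ, ∀ x, Tendsto (fun i => L i x) l (𝓝 (Λ x)) := by
  obtain ⟨Λ, -, hΛ⟩ := (WeakDual.isCompact_closedBall (0 : E →L[ℝ] ℝ) r).ultrafilter_le_nhds
    (l.map fun i => StrongDual.toWeakDual (L i)) (by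
      rw [le_principal_iff, Ultrafilter.mem_coe, Ultrafilter.mem_map]
      exact univ_mem' fun i => by simpa using hL i)
  exact ⟨WeakDual.toStrongDual Λ, fun x => ((WeakDual.eval_continuous x).tendsto Λ).comp hΛ⟩

/-- The functional on `C(βω)` averaging over the first `k` natural numbers. -/
noncomputable def averageFunctional (k : ℕ) : C(BetaOmega, ℝ) →L[ℝ] ℝ :=
  (k : ℝ)⁻¹ • ∑ j ∈ Finset.range k, ContinuousMap.evalCLM ℝ (pure j : BetaOmega)

theorem averageFunctional_apply (k : ℕ) (f : C(BetaOmega, ℝ)) :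
    averageFunctional k f = (k : ℝ)⁻¹ * ∑ j ∈ Finset.range k, f (pure j : BetaOmega) := by
  simp [averageFunctional]

theorem norm_averageFunctional_le (k : ℕ) : ‖averageFunctional k‖ ≤ 1 := by
  refine ContinuousLinearMap.opNorm_le_bound _ zero_le_one fun f => ?_
  have hsum : ‖∑ j ∈ Finset.range k, f (pure j : BetaOmega)‖ ≤ k * ‖f‖ := by
    simpa using norm_sum_le_of_le (Finset.range k) fun j _ =>
      f.norm_coe_le_norm (pure j : BetaOmega)
  rw [averageFunctional_apply, norm_mul, norm_inv, RCLike.norm_natCast, one_mul]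
  exact inv_mul_le_of_le_mul₀ k.cast_nonneg (norm_nonneg f) hsum

theorem averageFunctional_betaIndicator (k : ℕ) (B : Set ℕ) [DecidablePred (· ∈ B)] :
    averageFunctional k (betaIndicator B) = Nat.count (· ∈ B) k / k := by
  rw [averageFunctional_apply, div_eq_inv_mul, Nat.count_eq_card_filter_range]
  simp [betaIndicator_apply, Ultrafilter.mem_pure]

/-- The largest proportion of an initial segment of `ℕ` taken up by a set. -/
noncomputable def sUpperDensity : OuterMeasure ℕ :=
  ⨆ k, (uniformOn (Set.Iio k)).toOuterMeasure

theorem uniformOn_Iio_apply (k : ℕ) (B : Set ℕ) [DecidablePred (· ∈ B)] :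
    uniformOn (Set.Iio k) B = (Nat.count (· ∈ B) k : ENNReal) / k := by
  have hcount : Measure.count (Set.Iio k ∩ B) = Nat.count (· ∈ B) k := by
    rw [Nat.count_eq_card_filter_range, ← Measure.count_apply_finset]
    congr 1
    ext
    simp
  rw [uniformOn, cond_apply measurableSet_Iio, hcount, ← Finset.coe_Iio, Measure.count_apply_finset,
    Nat.card_Iio, ENNReal.div_eq_inv_mul]

theorem uniformOn_Iio_le_sUpperDensity (k : ℕ) (B : Set ℕ) :
    uniformOn (Set.Iio k) B ≤ sUpperDensity B :=
  le_iSup (fun k => (uniformOn (Set.Iio k)).toOuterMeasure) k B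

theorem ofReal_averageFunctional_le (k : ℕ) (B : Set ℕ) :
    ENNReal.ofReal (averageFunctional k (betaIndicator B)) ≤ sUpperDensity B := by
  classical
  refine le_trans ?_ (uniformOn_Iio_le_sUpperDensity k B)
  rw [averageFunctional_betaIndicator, uniformOn_Iio_apply]
  rcases k.eq_zero_or_pos with rfl | hk
  · simp
  · rw [ENNReal.ofReal_div_of_pos (by positivity), ENNReal.ofReal_natCast, ENNReal.ofReal_natCast]

theorem count_modEq_sdiff_Iio_mul_le {p : ℕ} (hp : 0 < p) (r k : ℕ) :
    Nat.count (· ∈ {j : ℕ | j ≡ r [MOD p]} \ Set.Iio p) k * p ≤ 2 * k := by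
  rcases le_or_gt k p with hkp | hpk
  · have hzero : Nat.count (· ∈ {j : ℕ | j ≡ r [MOD p]} \ Set.Iio p) k = 0 :=
      Nat.count_iff_forall_not.2 fun j hj hjp => hjp.2 (hj.trans_le hkp)
    rw [hzero, zero_mul]
    exact Nat.zero_le _
  · have hcount : Nat.count (· ∈ {j : ℕ | j ≡ r [MOD p]} \ Set.Iio p) k ≤ k / p + 1 :=
      calc _ ≤ Nat.count (· ≡ r [MOD p]) k := Nat.count_mono_left fun j _ hj => hj.1
        _ ≤ k / p + 1 := by
          rw [Nat.count_modEq_card k hp]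
          split_ifs <;> omega
    calc _ ≤ (k / p + 1) * p := Nat.mul_le_mul_right p hcount
      _ = k / p * p + p := by ring
      _ ≤ 2 * k := by linarith [Nat.div_mul_le_self k p]

theorem isDiffuse_sUpperDensity : IsDiffuse sUpperDensity := by
  intro F hF ε hε
  obtain ⟨p, hp⟩ := ENNReal.exists_inv_nat_lt (ENNReal.half_pos hε).ne'
  have hp0 : 0 < p := Nat.pos_of_ne_zero fun h => by simp [h] at hp
  have hcover : (⋃ r ∈ Set.Iio p, {j : ℕ | j ≡ r [MOD p]}) ∈ F :=
    mem_of_superset univ_mem fun j _ =>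
      Set.mem_biUnion (Set.mem_Iio.2 (Nat.mod_lt j hp0)) (Nat.mod_modEq j p).symm
  obtain ⟨r, -, hr⟩ := (Ultrafilter.finite_biUnion_mem_iff (Set.finite_Iio p)).1 hcover
  refine ⟨_ \ Set.Iio p, inter_mem hr (hF (Set.finite_Iio p).compl_mem_cofinite), ?_⟩
  simp only [sUpperDensity, OuterMeasure.iSup_apply, Measure.coe_toOuterMeasure]
  refine iSup_le fun k => ?_
  rw [uniformOn_Iio_apply]
  refine ENNReal.div_le_of_le_mul ?_
  calc (Nat.count (· ∈ {j : ℕ | j ≡ r [MOD p]} \ Set.Iio p) k : ENNReal)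
      ≤ 2 * k / p := by
        rw [ENNReal.le_div_iff_mul_le (by simp [hp0.ne']) (by simp)]
        exact_mod_cast count_modEq_sdiff_Iio_mul_le hp0 r k
    _ = 2 * (p : ENNReal)⁻¹ * k := by rw [div_eq_mul_inv]; ring
    _ ≤ 2 * (ε / 2) * k := by gcongr
    _ = ε * k := by rw [ENNReal.mul_div_cancel two_ne_zero ENNReal.ofNat_ne_top]

theorem exists_functional_le_sUpperDensity : ∃ Λ : C(BetaOmega, ℝ) →L[ℝ] ℝ,
    (∀ B : Set ℕ, B.Finite → Λ (betaIndicator B) = 0) ∧ Λ (betaIndicator Set.univ) = 1 ∧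
    ∀ B, ENNReal.ofReal (Λ (betaIndicator B)) ≤ sUpperDensity B := by
  classical
  obtain ⟨Λ, hΛ⟩ := exists_tendsto_of_norm_le (hyperfilter ℕ) norm_averageFunctional_le
  have htop : (hyperfilter ℕ : Filter ℕ) ≤ atTop := Nat.cofinite_eq_atTop ▸ hyperfilter_le_cofinite
  refine ⟨Λ, fun B hB => tendsto_nhds_unique (hΛ _) ?_, tendsto_nhds_unique (hΛ _) ?_, fun B =>
    le_of_tendsto (ENNReal.tendsto_ofReal (hΛ _)) (.of_forall fun k =>
      ofReal_averageFunctional_le k B)⟩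
  · have hcard (k : ℕ) : Nat.count (· ∈ B) k ≤ hB.toFinset.card := by
      rw [Nat.count_eq_card_filter_range]
      exact Finset.card_le_card fun n hn => hB.mem_toFinset.2 (Finset.mem_filter.1 hn).2
    simp only [averageFunctional_betaIndicator]
    exact squeeze_zero (fun k => by positivity)
      (fun k => div_le_div_of_nonneg_right (Nat.cast_le.2 (hcard k)) k.cast_nonneg)
      ((tendsto_const_div_atTop_nhds_zero_nat _).mono_left htop)
  · refine tendsto_const_nhds.congr' ?_
    filter_upwards [htop (eventually_gt_atTop 0)] with k hk
    rw [averageFunctional_betaIndicator]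
    simp [hk.ne']

theorem exists_functional_not_measurable_borel_pointwise : ∃ Λ : C(BetaOmega, ℝ) →L[ℝ] ℝ,
    ¬ Measurable[borelSigmaAlgebra (pointwiseTopology BetaOmega)] Λ := by
  obtain ⟨Λ, hfin, huniv, hle⟩ := exists_functional_le_sUpperDensity
  refine ⟨Λ, fun hΛ => ?_⟩
  obtain ⟨U, hU, hΛU⟩ := exists_seq_isOpen_measurable hΛ
  obtain ⟨A, N, hN, hopen⟩ := exists_isOpen_preimage_graft_of_diffuseInterior
    (fun n _ => exists_mem_diffuseInterior isDiffuse_sUpperDensity (hU n))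
    (ENNReal.inv_ne_zero.2 ENNReal.ofNat_ne_top : (2 : ENNReal)⁻¹ ≠ 0)
  have hadd (B C : Set ℕ) (hBC : Disjoint B C) :
      Λ (betaIndicator (B ∪ C)) = Λ (betaIndicator B) + Λ (betaIndicator C) := by
    rw [betaIndicator_union hBC, map_add]
  have hgraft (x : N → Bool) :
      Λ (betaIndicator (graft A x)) = Λ (betaIndicator (A \ N)) + Λ (betaIndicator (codedSet x)) :=
    hadd _ _ (Set.disjoint_sdiff_left.mono_right (codedSet_subset x))
  have hmeas : Measurable fun x : N → Bool => Λ (betaIndicator (graft A x)) := by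
    refine @Measurable.comp _ _ _ _ (.generateFrom (Set.range U)) _ _ _ hΛU
      (@measurable_generateFrom _ _ (_) _ _ ?_)
    rintro _ ⟨n, rfl⟩
    exact (hopen n).measurableSet
  simp only [hgraft] at hmeas
  have hΛN : Λ (betaIndicator N) = 0 := eq_zero_of_additive_of_measurable hadd hfin
    (by simpa using hmeas.sub_const (Λ (betaIndicator (A \ N))))
  have hΛNc : Λ (betaIndicator Nᶜ) = 1 := by
    rw [← huniv, ← Set.union_compl_self N, hadd _ _ disjoint_compl_right, hΛN, zero_add]
  have hone := (hle Nᶜ).trans hN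
  rw [hΛNc, ENNReal.ofReal_one] at hone
  exact hone.not_gt ENNReal.one_half_lt_one

end Density

/-! ### Weakly Borel sets and a norm closed set -/

section SilverOpen

variable {α : Type*}

/-- A collection of sets is Silver open if each of its members `A` has, inside every infinite set,
an infinite set `C` on which `A` can be changed arbitrarily without leaving the collection. -/
def IsSilverOpen (𝒰 : Set (Set α)) : Prop :=
  ∀ A ∈ 𝒰, ∀ N : Set α, N.Infinite → ∃ C ⊆ N, C.Infinite ∧ cell A C ⊆ 𝒰

theorem exists_infinite_subset_forall_abs_lt (φ : C(Ultrafilter α, ℝ) →L[ℝ] ℝ) {N : Set α}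
    (hN : N.Infinite) {ε : ℝ} (hε : 0 < ε) :
    ∃ C ⊆ N, C.Infinite ∧ ∀ P ⊆ C, |φ (betaIndicator P)| < ε := by
  by_contra! hlarge
  let f (i j : ℕ) : α := hN.natEmbedding N (Nat.pair i j)
  have hf {i j i' j' : ℕ} (h : f i j = f i' j') : i = i' ∧ j = j' :=
    Nat.pair_eq_pair.1 ((hN.natEmbedding N).injective (Subtype.val_injective h))
  choose P hPf hP using fun i => hlarge (Set.range (f i))
    (Set.range_subset_iff.2 fun j => Subtype.coe_prop _)
    (Set.infinite_range_of_injective fun _ _ h => (hf h).2)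
  obtain ⟨M, hM⟩ := exists_nat_gt (‖φ‖ / ε)
  have hdisj : (Finset.range M : Set ℕ).PairwiseDisjoint P := by
    refine fun i _ j _ hij => Set.disjoint_left.2 fun a ha ha' => hij ?_
    obtain ⟨k, rfl⟩ := hPf i ha
    obtain ⟨k', hk'⟩ := hPf j ha'
    exact (hf hk').1.symm
  have hcard := card_mul_le_norm φ hdisj fun i _ => hP i
  rw [Finset.card_range, ← le_div_iff₀ hε] at hcard
  exact hcard.not_gt hM

theorem exists_infinite_subset_forall_mem_abs_lt (T : Finset (C(Ultrafilter α, ℝ) →L[ℝ] ℝ))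
    {N : Set α} (hN : N.Infinite) {ε : (C(Ultrafilter α, ℝ) →L[ℝ] ℝ) → ℝ} (hε : ∀ φ ∈ T, 0 < ε φ) :
    ∃ C ⊆ N, C.Infinite ∧ ∀ φ ∈ T, ∀ P ⊆ C, |φ (betaIndicator P)| < ε φ := by
  classical
  induction T using Finset.induction_on with
  | empty => exact ⟨N, subset_rfl, hN, by simp⟩
  | insert φ T _ ih =>
    rw [Finset.forall_mem_insert] at hε
    obtain ⟨C, hCN, hC, hCT⟩ := ih hε.2
    obtain ⟨C', hC'C, hC', hφ⟩ := exists_infinite_subset_forall_abs_lt φ hC hε.1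
    exact ⟨C', hC'C.trans hCN, hC', (Finset.forall_mem_insert _ _ _).2
      ⟨hφ, fun ψ hψ P hP => hCT ψ hψ P (hP.trans hC'C)⟩⟩

theorem isSilverOpen_preimage_betaIndicator {U : Set C(Ultrafilter α, ℝ)}
    (hU : IsOpen[weakTopology (Ultrafilter α)] U) : IsSilverOpen (betaIndicator ⁻¹' U) := by
  intro A hA N hN
  obtain ⟨V, hV, rfl⟩ := isOpen_induced_iff.1 hU
  obtain ⟨W, hW, rfl⟩ := isOpen_induced_iff.1 hV
  obtain ⟨I, u, hu, huW⟩ := isOpen_pi_iff.1 hW _ hA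
  choose! ε hε hεu using fun φ hφ => Metric.isOpen_iff.1 (hu φ hφ).1 _ (hu φ hφ).2
  obtain ⟨C, hCN, hC, hCI⟩ := exists_infinite_subset_forall_mem_abs_lt I hN
    (ε := fun φ => ε φ / 2) fun φ hφ => half_pos (hε φ hφ)
  refine ⟨C, hCN, hC, fun B hB => huW fun φ hφ => hεu φ hφ ?_⟩
  have hAB : |φ (betaIndicator (A \ B))| < ε φ / 2 := hCI φ hφ _ fun a ha => by
    by_contra haC
    exact ha.2 ((hB a haC).2 ha.1)
  have hBA : |φ (betaIndicator (B \ A))| < ε φ / 2 := hCI φ hφ _ fun a ha => by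
    by_contra haC
    exact ha.2 ((hB a haC).1 ha.1)
  change |φ (betaIndicator B) - φ (betaIndicator A)| < ε φ
  rw [← betaIndicator_sdiff_add_inter A B, ← betaIndicator_sdiff_add_inter B A, Set.inter_comm B A,
    map_add, map_add, add_sub_add_right_eq_sub]
  exact (abs_sub _ _).trans_lt (by linarith)

theorem IsSilverOpen.exists_decided {𝒰 : Set (Set α)} (h𝒰 : IsSilverOpen 𝒰) (A : Set α)
    {N : Set α} (hN : N.Infinite) : ∃ A' ∈ cell A N, ∃ C ⊆ N, C.Infinite ∧
      ∀ B ∈ cell A' C, B ∈ 𝒰 → cell B C ⊆ 𝒰 := by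
  by_cases h : ∃ B ∈ cell A N, B ∈ 𝒰
  · obtain ⟨B, hBN, hB⟩ := h
    obtain ⟨C, hCN, hC, hC𝒰⟩ := h𝒰 B hB N hN
    exact ⟨B, hBN, C, hCN, hC, fun B' hB' _ => (cell_subset_cell hB' subset_rfl).trans hC𝒰⟩
  · exact ⟨A, self_mem_cell A N, N, subset_rfl, hN, fun B hBN hB => absurd ⟨B, hBN, hB⟩ h⟩

theorem IsSilverOpen.exists_decided_finset {𝒰 : Set (Set α)} (h𝒰 : IsSilverOpen 𝒰) (K : Finset α)
    (A : Set α) {N : Set α} (hN : N.Infinite) :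
    ∃ A' ∈ cell A (K ∪ N), ∃ C ⊆ N, C.Infinite ∧
      ∀ B ∈ cell A' (K ∪ C), B ∈ 𝒰 → cell B C ⊆ 𝒰 := by
  classical
  induction K using Finset.induction_on generalizing A N with
  | empty => simpa using h𝒰.exists_decided A hN
  | insert k K _ ih =>
    -- Decide the sets with one value at `k` first, then those with the other value.
    obtain ⟨A₁, hA₁, C₁, hC₁N, hC₁, h₁⟩ := ih A hN
    obtain ⟨A₂, hA₂, C₂, hC₂, hC₂i, h₂⟩ := ih (symmDiff A₁ {k}) hC₁
    simp only [cell, Set.mem_ofPred_eq, Set.mem_union, Finset.mem_coe, Set.mem_symmDiff,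
      Set.mem_singleton_iff] at hA₁ hA₂
    refine ⟨A₂, fun a ha => ?_, C₂, hC₂.trans hC₁N, hC₂i, fun B hB hB𝒰 => ?_⟩
    · grind
    simp only [cell, Set.mem_ofPred_eq, Finset.coe_insert, Set.mem_union, Set.mem_insert_iff,
      Finset.mem_coe] at hB
    by_cases hk : k ∈ B ↔ k ∈ A₂
    · exact h₂ B (fun a ha => by grind) hB𝒰
    · exact (cell_subset_cell (self_mem_cell B C₁) hC₂).trans (h₁ B (fun a ha => by grind) hB𝒰)

theorem IsSilverOpen.exists_fusion_step {𝒰 : Set (Set α)} (h𝒰 : IsSilverOpen 𝒰)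
    (p : Set α × Finset α × {N : Set α // N.Infinite}) :
    ∃ q : Set α × Finset α × {N : Set α // N.Infinite}, p.2.1 ⊂ q.2.1 ∧
      (↑q.2.1 ∪ q.2.2.1 : Set α) ⊆ ↑p.2.1 ∪ p.2.2.1 ∧ q.1 ∈ cell p.1 (↑p.2.1 ∪ p.2.2.1) ∧
      ∀ B ∈ cell q.1 (↑q.2.1 ∪ q.2.2.1), B ∈ 𝒰 → cell B q.2.2.1 ⊆ 𝒰 := by
  classical
  obtain ⟨A, K, N, hN⟩ := p
  obtain ⟨k, hkN, hkK⟩ := hN.exists_notMem_finset K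
  obtain ⟨A', hA', C, hCN, hC, hdec⟩ := h𝒰.exists_decided_finset (insert k K) A hN
  have hsub {M : Set α} (hM : M ⊆ N) : (↑(insert k K) ∪ M : Set α) ⊆ ↑K ∪ N := by
    rw [Finset.coe_insert, Set.insert_union]
    exact Set.insert_subset (.inr hkN) (Set.union_subset_union_right _ hM)
  exact ⟨(A', insert k K, ⟨C, hC⟩), Finset.ssubset_insert hkK, hsub hCN,
    cell_subset_cell (self_mem_cell A _) (hsub subset_rfl) hA', hdec⟩

theorem exists_isOpen_preimage_graft_of_isSilverOpen [Infinite α] {𝒰 : ℕ → Set (Set α)}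
    (h𝒰 : ∀ n, IsSilverOpen (𝒰 n)) : ∃ A N : Set α, N.Infinite ∧
      ∀ n, IsOpen ((graft A : (N → Bool) → Set α) ⁻¹' 𝒰 n) := by
  choose next hssub hanti hcell hdec using fun i => (h𝒰 i).exists_fusion_step
  let p (i : ℕ) : Set α × Finset α × {N : Set α // N.Infinite} :=
    Nat.rec (∅, ∅, ⟨Set.univ, Set.infinite_univ⟩) next i
  let K (i : ℕ) : Finset α := (p i).2.1
  let M (i : ℕ) : Set α := K i ∪ (p i).2.2.1
  have hK : StrictMono K := strictMono_nat_of_lt_succ fun i => hssub i (p i)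
  have hM : Antitone M := antitone_nat_of_succ_le fun i => hanti i (p i)
  obtain ⟨A, hA⟩ := exists_forall_mem_cell (A := fun i => (p i).1) (N := M)
    (fun i => hanti i (p i)) fun i => hcell i (p i)
  have hKM (i : ℕ) : ⋃ j, (K j : Set α) ⊆ M i := Set.iUnion_subset fun j => by
    rcases le_total i j with hij | hji
    · exact Set.subset_union_left.trans (hM hij)
    · exact (Finset.coe_subset.2 (hK.monotone hji)).trans Set.subset_union_left
  refine ⟨A, ⋃ i, K i, ?_, fun n => isOpen_preimage_graft fun B hB hBn =>
    ⟨K (n + 1), fun B' hB' hB'B => ?_⟩⟩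
  · exact Set.infinite_iUnion (Finset.coe_injective.comp hK.injective)
  · have hBA := cell_subset_cell (hA (n + 1)) (hKM (n + 1)) hB
    have hB'A := cell_subset_cell (hA (n + 1)) (hKM (n + 1)) hB'
    refine hdec n (p n) B hBA hBn fun a ha => ?_
    by_cases haK : a ∈ (K (n + 1) : Set α)
    · exact hB'B a (Set.notMem_compl_iff.2 haK)
    · have haM : a ∉ M (n + 1) := fun h => h.elim haK ha
      rw [hB'A a haM, hBA a haM]

end SilverOpen

section Parity

variable {α : Type*}

variable (α) in
theorem exists_parity :
    ∃ p : Set α → Prop, ∀ A a, p (symmDiff A {a}) ↔ ¬ p A := by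
  classical
  obtain ⟨g, hg⟩ := (Finsupp.lcoeFun : (α →₀ ZMod 2) →ₗ[ZMod 2] α → ZMod 2)
    |>.exists_leftInverse_of_injective (LinearMap.ker_eq_bot.2 DFunLike.coe_injective)
  let ψ : (α → ZMod 2) →ₗ[ZMod 2] ZMod 2 := Finsupp.linearCombination (ZMod 2) (fun _ => 1) ∘ₗ g
  have hψ (a : α) : ψ (Pi.single a (1 : ZMod 2)) = 1 := by
    have hga : g (Pi.single a (1 : ZMod 2)) = Finsupp.single a 1 := by
      rw [← Finsupp.single_eq_pi_single]
      exact LinearMap.congr_fun hg (Finsupp.single a 1)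
    simp [ψ, hga]
  refine ⟨fun A => ψ (A.indicator 1) = 0, fun A a => ?_⟩
  have hsum : (symmDiff A {a}).indicator (1 : α → ZMod 2) = A.indicator 1 + Pi.single a 1 := by
    ext b
    rcases eq_or_ne b a with rfl | hb
    · by_cases hA : b ∈ A <;> simp [Set.indicator, Set.mem_symmDiff, hA, CharTwo.add_self_eq_zero]
    · by_cases hA : b ∈ A <;> simp [Set.indicator, Set.mem_symmDiff, hA, hb]
  have hflip (c : ZMod 2) : c + 1 = 0 ↔ ¬ c = 0 := by
    revert c
    decide
  simpa only [hsum, map_add, hψ] using hflip _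

theorem graft_flipOn_singleton {N : Set α} (A : Set α) (x : N → Bool) (a : N) :
    graft A (flipOn {a} x) = symmDiff (graft A x) {↑a} := by
  ext b
  by_cases hb : b ∈ N
  · by_cases hba : b = a
    · subst hba
      simp [mem_graft_of_mem, Set.mem_symmDiff, flipOn_apply_of_mem]
    · have hbas : (⟨b, hb⟩ : N) ∉ ({a} : Set N) := fun h => hba (congrArg Subtype.val h)
      simp [mem_graft_of_mem hb, Set.mem_symmDiff, flipOn_apply_of_notMem hbas, hba]
  · have hba : b ≠ a := fun h => hb (h ▸ a.2)
    simp [graft_mem_cell A _ b hb, Set.mem_symmDiff, hba]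

theorem one_le_dist_betaIndicator {A B : Set α} (h : A ≠ B) :
    1 ≤ dist (betaIndicator A) (betaIndicator B) := by
  obtain ⟨a, ha⟩ : ∃ a, ¬ (a ∈ A ↔ a ∈ B) := by
    by_contra! hAB
    exact h (Set.ext hAB)
  refine le_trans ?_ (ContinuousMap.dist_apply_le_dist (pure a : Ultrafilter α))
  simp only [betaIndicator_apply, Ultrafilter.mem_pure]
  by_cases hA : a ∈ A <;> by_cases hB : a ∈ B <;> simp [hA, hB] at ha ⊢

theorem betaIndicator_injective :
    Function.Injective (betaIndicator : Set α → C(Ultrafilter α, ℝ)) := fun A B h => by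
  by_contra hAB
  exact one_pos.not_ge ((one_le_dist_betaIndicator hAB).trans_eq (dist_eq_zero.2 h))

theorem isClosed_image_betaIndicator (𝒰 : Set (Set α)) : IsClosed (betaIndicator '' 𝒰) := by
  refine Metric.isClosed_of_pairwise_le_dist one_pos ?_
  rintro _ ⟨A, -, rfl⟩ _ ⟨B, -, rfl⟩ hAB
  exact one_le_dist_betaIndicator fun h => hAB (congrArg betaIndicator h)

theorem not_borel_norm_le_borel_weak :
    ¬ borelSigmaAlgebra (normTopology BetaOmega) ≤ borelSigmaAlgebra (weakTopology BetaOmega) := by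
  intro hle
  obtain ⟨p, hp⟩ := exists_parity ℕ
  have hZ : MeasurableSet[borelSigmaAlgebra (weakTopology BetaOmega)]
      (betaIndicator '' {A | p A}) :=
    hle _ (.of_compl (MeasurableSpace.measurableSet_generateFrom
      (isClosed_image_betaIndicator _).isOpen_compl))
  obtain ⟨U, hU, hZU⟩ := exists_seq_isOpen_measurable (f := (· ∈ betaIndicator '' {A | p A}))
    (@measurable_mem _ _ (_) |>.2 hZ)
  obtain ⟨A, N, hN, hopen⟩ := exists_isOpen_preimage_graft_of_isSilverOpen fun n =>
    isSilverOpen_preimage_betaIndicator (hU n)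
  have hmeas : Measurable fun x : N → Bool =>
      betaIndicator (graft A x) ∈ betaIndicator '' {A | p A} := by
    refine @Measurable.comp _ _ _ _ (.generateFrom (Set.range U)) _ _ _ hZU
      (@measurable_generateFrom _ _ (_) _ _ ?_)
    rintro _ ⟨n, rfl⟩
    exact (hopen n).measurableSet
  have : Infinite N := hN.to_subtype
  refine not_baireMeasurableSet_of_parity (fun x a => ?_)
    (measurableSet_setOfPred.2 hmeas).baireMeasurableSet
  simp only [Set.mem_ofPred_eq, betaIndicator_injective.mem_set_image, graft_flipOn_singleton, hp]

end Parity

/-! ### Comparison of the σ-algebras -/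

section Comparison

variable {X : Type*} {t t' : TopologicalSpace X}

theorem baireSigmaAlgebra_anti (h : t ≤ t') : baireSigmaAlgebra t' ≤ baireSigmaAlgebra t := by
  refine iSup_le fun f => ?_
  rw [← BorelSpace.measurable_eq (α := ℝ), ← measurable_iff_comap_le]
  exact measurable_baireSigmaAlgebra (continuous_le_dom h f.2)

theorem baireSigmaAlgebra_le_borelSigmaAlgebra (t : TopologicalSpace X) :
    baireSigmaAlgebra t ≤ borelSigmaAlgebra t :=
  iSup_le fun f => borel_comap.symm.trans_le (borel_anti (continuous_iff_le_induced.1 f.2))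

theorem normTopology_le_weakTopology (K : Type*) [TopologicalSpace K] [CompactSpace K] :
    normTopology K ≤ weakTopology K :=
  continuous_iff_le_induced.1 (toWeakSpaceCLM ℝ C(K, ℝ)).continuous

theorem weakTopology_le_pointwiseTopology (K : Type*) [TopologicalSpace K] [CompactSpace K] :
    weakTopology K ≤ pointwiseTopology K :=
  continuous_iff_le_induced.1 <| @continuous_pi _ _ _ (weakTopology K) _ _ fun x =>
    continuous_induced_toWeakSpace (ContinuousMap.evalCLM ℝ x)

end Comparison

theorem proposition5p2 :
    (∀ (ι : Type*) [Uncountable ι] (A : ι → Set ℕ) (F : ι → BetaOmega),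
      IsAlmostDisjointFamily A → (∀ i, F i ∈ omegaStar) → (∀ i, A i ∈ F i) →
        IsOpen[pointwiseTopology BetaOmega] (positiveSomewhere F) ∧
        ¬ MeasurableSet[baireSigmaAlgebra (weakTopology BetaOmega)] (positiveSomewhere F)) ∧
    ¬ (borelSigmaAlgebra (pointwiseTopology BetaOmega) ≤
        baireSigmaAlgebra (weakTopology BetaOmega)) ∧
    (baireSigmaAlgebra (pointwiseTopology BetaOmega) <
        borelSigmaAlgebra (pointwiseTopology BetaOmega) ∧
      baireSigmaAlgebra (pointwiseTopology BetaOmega) <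
        baireSigmaAlgebra (weakTopology BetaOmega) ∧
      borelSigmaAlgebra (pointwiseTopology BetaOmega) <
        borelSigmaAlgebra (weakTopology BetaOmega) ∧
      baireSigmaAlgebra (weakTopology BetaOmega) <
        borelSigmaAlgebra (weakTopology BetaOmega) ∧
      borelSigmaAlgebra (weakTopology BetaOmega) <
        borelSigmaAlgebra (normTopology BetaOmega)) := by
  have hpw := weakTopology_le_pointwiseTopology BetaOmega
  have hnw := normTopology_le_weakTopology BetaOmega
  have hp := baireSigmaAlgebra_le_borelSigmaAlgebra (pointwiseTopology BetaOmega)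
  have hw := baireSigmaAlgebra_le_borelSigmaAlgebra (weakTopology BetaOmega)
  have hV := not_borel_pointwise_le_baire_weak
  obtain ⟨Λ, hΛ⟩ := exists_functional_not_measurable_borel_pointwise
  have hΛw : Measurable[baireSigmaAlgebra (weakTopology BetaOmega)] Λ :=
    measurable_baireSigmaAlgebra (continuous_induced_toWeakSpace Λ)
  refine ⟨fun ι _ A F hA hF hAF => ⟨isOpen_positiveSomewhere F,
    not_measurableSet_positiveSomewhere hA hF hAF⟩, hV, ?_, ?_, ?_, ?_, ?_⟩
  · exact hp.lt_of_not_ge fun h => hV (h.trans (baireSigmaAlgebra_anti hpw))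
  · exact (baireSigmaAlgebra_anti hpw).lt_of_not_ge fun h => hΛ (hΛw.mono (h.trans hp) le_rfl)
  · exact (borel_anti hpw).lt_of_not_ge fun h => hΛ (hΛw.mono (hw.trans h) le_rfl)
  · exact hw.lt_of_not_ge fun h => hV ((borel_anti hpw).trans h)
  · exact (borel_anti hnw).lt_of_not_ge not_borel_norm_le_borel_weak
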